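/- Let $\mathcal H$ be a real separable Hilbert space, let $f\colon\mathcal H\to\,]-\infty,+\infty]$ be a proper lower semicontinuous convex function with domain $\operatorname{dom} f=\{y\in\mathcal H : f(y)<+\infty\}$, let $C$ be a nonempty closed convex subset of $\mathcal H$ with projection $P_C$ and indicator function $\iota_C$ (equal to $0$ on $C$ and to $+\infty$ elsewhere), and let $\gamma>0$. For a proper lower semicontinuous convex function $h\colon\mathcal H\to\,]-\infty,+\infty]$ and $u\in\mathcal H$, let $\operatorname{prox}_h u$ denote the unique minimizer of $y\mapsto \frac12\|y-u\|^2+h(y)$ over $\mathcal H$. Suppose that at least one of the following holds: (a) $C\cap\operatorname{int}\operatorname{dom} f\neq\varnothing$; (b) $\operatorname{dom} f\cap\operatorname{int} C\neq\varnothing$; (c) $\mathcal H$ is finite dimensional and the relative interiors of $C$ and of $\operatorname{dom} f$ have a common point. Let $x\in\mathcal H$ and let $(\tau_m)_{m\in\mathbb N}$ be real numbers with $\inf_{m}\tau_m>0$ and $\sup_m\tau_m\le 2$. For $\kappa>0$ and $z_0\in\mathcal H$ consider the iteration, for every $m\in\mathbb N$, $$z_{m+\frac12}=P_C\Big(\frac{z_m+\kappa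 x}{1+\kappa}\Big),\qquad z_{m+1}=z_m+\tau_m\big(\operatorname{prox}_{\kappa\gamma f}(2z_{m+\frac12}-z_m)-z_{m+\frac12}\big).$$ Then $y\mapsto\frac12\|y-x\|^2+\iota_C(y)+\gamma f(y)$ has a unique minimizer $\operatorname{prox}_{\iota_C+\gamma f}x$, and: (i) for every $\kappa>0$ and every $z_0\in\mathcal H$, the sequence $(z_{m+\frac12})_{m\in\mathbb N}$ converges strongly (in norm) to $\operatorname{prox}_{\iota_C+\gamma f}x$; (ii) for $\kappa=1$ and $z_0=2\operatorname{prox}_{\gamma f}x-x$, if $\operatorname{prox}_{\gamma f}x\in C$, then $z_{m+\frac12}=\operatorname{prox}_{\iota_C+\gamma f}x$ for every $m\in\mathbb N$. -/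

import Mathlib

open Filter Topology

noncomputable section

namespace ConvexProx

variable {H : Type*}

/-- Effective domain of an extended-real-valued function. -/
def dom (f : H → EReal) : Set H := {x | f x < ⊤}

open Classical in
/-- Convex-analytic indicator function of a set: `0` on the set, `+∞` off it. -/
def indicator (C : Set H) (y : H) : EReal := if y ∈ C then 0 else ⊤

variable [NormedAddCommGroup H]

/-- The class of proper lower semicontinuous convex functions with values in `]-∞, +∞]`.
As `f` never takes the value `-∞` and the weights are positive, all operations in the convexity
inequality are the usual ones on `]-∞, +∞]`. -/
structure Gamma0 [NormedSpace ℝ H] (f : H → EReal) : Prop where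
  ne_bot : ∀ x, f x ≠ ⊥
  proper : ∃ x, f x ≠ ⊤
  lsc : LowerSemicontinuous f
  convex : ∀ x y : H, ∀ a b : ℝ, 0 < a → 0 < b → a + b = 1 →
    f (a • x + b • y) ≤ (a : EReal) * f x + (b : EReal) * f y

/-- The objective `y ↦ ½‖y - x‖² + h y` whose minimizer is the proximal point of `x`. -/
def proxObjective (h : H → EReal) (x y : H) : EReal :=
  ((1 / 2 * ‖y - x‖ ^ 2 : ℝ) : EReal) + h y

/-- `p` minimizes `y ↦ ½‖y - x‖² + h y` over the whole space. -/
def IsProxPoint (h : H → EReal) (x p : H) : Prop :=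
  ∀ y, proxObjective h x p ≤ proxObjective h x y

open Classical in
/-- The proximity operator: the minimizer of `y ↦ ½‖y - x‖² + h y` (it exists and is unique for a
proper lower semicontinuous convex `h` on a Hilbert space; `0` if there is no minimizer). -/
def prox (h : H → EReal) (x : H) : H :=
  if hp : ∃ p, IsProxPoint h x p then hp.choose else 0

/-- `p` is a point of `C` nearest to `x`. -/
def IsNearest (C : Set H) (x p : H) : Prop :=
  p ∈ C ∧ ∀ q ∈ C, ‖x - p‖ ≤ ‖x - q‖

open Classical in
/-- The projection onto `C`: the point of `C` nearest to `x` (it exists and is unique for a nonempty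
closed convex subset of a Hilbert space; `0` if there is no nearest point). -/
def proj (C : Set H) (x : H) : H :=
  if hp : ∃ p, IsNearest C x p then hp.choose else 0

/-- The (exact) Douglas-Rachford iteration for the proximity operator of `ι_C + γ f` at `x`, with
parameter `κ` and relaxation parameters `τ`. Here `z m` is the iterate `z_m` and `zhalf m` is the
intermediate iterate `z_{m+1/2}`; the starting point `z 0` is free. -/
structure IsDouglasRachford [NormedSpace ℝ H] (C : Set H) (f : H → EReal) (γ κ : ℝ) (x : H)
    (τ : ℕ → ℝ) (z zhalf : ℕ → H) : Prop where
  half : ∀ m, zhalf m = proj C ((1 + κ)⁻¹ • (z m + κ • x))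
  next : ∀ m, z (m + 1) = z m + τ m •
    (prox (fun y => ((κ * γ : ℝ) : EReal) * f y) ((2 : ℝ) • zhalf m - z m) - zhalf m)

end ConvexProx

end

/-!
Write `g = γ f` and let `p` be the minimizer of `½‖· - x‖² + ι_C + g`. It exists and is unique
because the objective is lower semicontinuous, strongly convex and bounded below
(`Gamma0.exists_isProxPoint`, `Gamma0.isProxPoint_unique`), and Fermat's rule
(`Gamma0.isProxPoint_iff`) says that `x - p` is a subgradient of `ι_C + g` at `p`.

The constraint qualification enters only through the sum rule
(`Gamma0.exists_normal_add_subgradient`), which splits `x - p = u + v` with `u` normal to `C` at `p`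
and `v` a subgradient of `g` at `p`. It is proved by separating the tilted epigraph of `g` from
`C × ]-∞, 0[`. In case (a) the epigraph has interior points by Baire's theorem, in case (b) the
cylinder has, and in case (c) proper separation of convex sets in finite dimension applies. In all
three cases every element of `dom f - C` has a small negative multiple in `dom f - C`. A vertical
hyperplane would therefore contain both sets, against proper separation.

Given the splitting, `z = p + κ (u + p - x)` is a fixed point of the iteration with shadow `p`.
Monotonicity of the subgradients of `g`, together with the strong monotonicity with modulus `κ` that
the quadratic term adds to the normal cone of `C`, gives
`‖z_{m+1} - z‖² ≤ ‖z_m - z‖² - 2 τ_m κ ‖z_{m+1/2} - p‖²` whenever `0 ≤ τ_m ≤ 2`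
(`sq_norm_add_smul_sub_le`). As `τ_m` is bounded away from zero, the squared errors
`‖z_{m+1/2} - p‖²` are summable, whence strong convergence (`IsDouglasRachford.tendsto`).

If the proximal point `q` of `g` at `x` lies in `C`, it minimizes the constrained objective as well,
and with `κ = 1` the starting point `2q - x` is itself a fixed point of the iteration
(`IsDouglasRachford.zhalf_eq`).
-/

section

open scoped RealInnerProductSpace Pointwise

namespace ConvexProx

/-! ### Preliminaries -/

theorem indicator_add_of_mem {H : Type*} {C : Set H} {y : H} (hy : y ∈ C) (r : EReal) :
    indicator C y + r = r := by
  simp [indicator, hy]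

theorem proxObjective_eq_top {H : Type*} [NormedAddCommGroup H] {h : H → EReal} (x : H) {y : H}
    (hy : h y = ⊤) : proxObjective h x y = ⊤ := by
  rw [proxObjective, hy, EReal.coe_add_top]

theorem proj_eq_self {H : Type*} [NormedAddCommGroup H] {C : Set H} {x : H}
    (hx : x ∈ C) : proj C x = x := by
  have hex : ∃ p, IsNearest C x p := ⟨x, hx, fun q _ => by simp⟩
  have hnear : IsNearest C x (proj C x) := by
    rw [proj, dif_pos hex]
    exact hex.choose_spec
  have := hnear.2 x hx
  rw [sub_self, norm_zero, norm_le_zero_iff, sub_eq_zero] at this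
  exact this.symm

theorem le_zero_of_forall_le_mul {a b : ℝ} (h : ∀ t : ℝ, 0 < t → t < 1 → a ≤ t * b) : a ≤ 0 := by
  have ht : Tendsto (fun t : ℝ => t * b) (𝓝[>] 0) (𝓝 0) := by
    have : Tendsto (fun t : ℝ => t * b) (𝓝 0) (𝓝 (0 * b)) := (continuous_mul_const b).tendsto 0
    rw [zero_mul] at this
    exact this.mono_left nhdsWithin_le_nhds
  refine ge_of_tendsto ht ?_
  filter_upwards [Ioo_mem_nhdsGT (zero_lt_one' ℝ)] with t ht using h t ht.1 ht.2

/-! ### Subgradients and operations on functions in `Γ₀` -/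

section Basic

variable {H : Type*} [NormedAddCommGroup H] [InnerProductSpace ℝ H] {f h : H → EReal}

/-- `v` is a subgradient of `h` at the point `p` of its domain. The inequality is stated between
real numbers, at the points where `h` is finite; this is the usual notion when `h` does not take the
value `-∞`. -/
def IsSubgradientAt (h : H → EReal) (p v : H) : Prop :=
  h p ≠ ⊤ ∧ ∀ y, h y ≠ ⊤ → (h p).toReal + ⟪v, y - p⟫ ≤ (h y).toReal

theorem Gamma0.coe_toReal (hf : Gamma0 f) {x : H} (hx : f x ≠ ⊤) : ((f x).toReal : EReal) = f x :=
  EReal.coe_toReal hx (hf.ne_bot x)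

theorem Gamma0.convexOn (hf : Gamma0 f) : ConvexOn ℝ (dom f) fun y => (f y).toReal := by
  have key : ∀ ⦃x⦄, x ∈ dom f → ∀ ⦃y⦄, y ∈ dom f → ∀ ⦃a b : ℝ⦄, 0 < a → 0 < b → a + b = 1 →
      f (a • x + b • y) ≤ ((a * (f x).toReal + b * (f y).toReal : ℝ) : EReal) := by
    intro x hx y hy a b ha hb hab
    have := hf.convex x y a b ha hb hab
    rwa [← hf.coe_toReal (ne_of_lt hx), ← hf.coe_toReal (ne_of_lt hy), ← EReal.coe_mul,
      ← EReal.coe_mul, ← EReal.coe_add] at this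
  refine convexOn_iff_forall_pos.2 ⟨convex_iff_forall_pos.2 ?_, ?_⟩
  · intro x hx y hy a b ha hb hab
    exact (key hx hy ha hb hab).trans_lt (EReal.coe_lt_top _)
  · intro x hx y hy a b ha hb hab
    have := EReal.toReal_le_toReal (key hx hy ha hb hab) (hf.ne_bot _) (EReal.coe_ne_top _)
    rwa [EReal.toReal_coe] at this

theorem Gamma0.const_mul (hf : Gamma0 f) {c : ℝ} (hc : 0 < c) :
    Gamma0 fun y => (c : EReal) * f y where
  ne_bot x := by
    rcases eq_or_ne (f x) ⊤ with h | h
    · simp [h, EReal.coe_mul_top_of_pos hc]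
    · rw [← hf.coe_toReal h, ← EReal.coe_mul]
      exact EReal.coe_ne_bot _
  proper := by
    obtain ⟨x, hx⟩ := hf.proper
    refine ⟨x, ?_⟩
    rw [← hf.coe_toReal hx, ← EReal.coe_mul]
    exact EReal.coe_ne_top _
  lsc := by
    refine lowerSemicontinuous_iff_isClosed_preimage.2 fun a => ?_
    convert lowerSemicontinuous_iff_isClosed_preimage.1 hf.lsc (a / c) using 1
    ext y
    simp only [Set.mem_preimage, Set.mem_Iic]
    rw [EReal.le_div_iff_mul_le (EReal.coe_pos.2 hc) (EReal.coe_ne_top _), mul_comm]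
  convex x y a b ha hb hab := by
    have hc' : (0 : EReal) ≤ c := EReal.coe_nonneg.2 hc.le
    calc (c : EReal) * f (a • x + b • y)
        ≤ c * (a * f x + b * f y) := mul_le_mul_of_nonneg_left (hf.convex x y a b ha hb hab) hc'
      _ = a * (c * f x) + b * (c * f y) := by
        rw [EReal.left_distrib_of_nonneg_of_ne_top hc' (EReal.coe_ne_top _),
          mul_left_comm, mul_left_comm (c : EReal)]

theorem Gamma0.const_mul_ne_top_iff (hf : Gamma0 f) {c : ℝ} (hc : 0 < c) {x : H} :
    (c : EReal) * f x ≠ ⊤ ↔ f x ≠ ⊤ := by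
  constructor
  · rintro h h'
    exact h (by rw [h', EReal.coe_mul_top_of_pos hc])
  · intro h
    rw [← hf.coe_toReal h, ← EReal.coe_mul]
    exact EReal.coe_ne_top _

theorem dom_const_mul (hf : Gamma0 f) {c : ℝ} (hc : 0 < c) :
    dom (fun y => (c : EReal) * f y) = dom f := by
  ext x
  simpa [dom, lt_top_iff_ne_top] using hf.const_mul_ne_top_iff hc

theorem Gamma0.isSubgradientAt_const_mul (hf : Gamma0 f) {c : ℝ} (hc : 0 < c) {p v : H}
    (hv : IsSubgradientAt f p v) : IsSubgradientAt (fun y => (c : EReal) * f y) p (c • v) := by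
  refine ⟨(hf.const_mul_ne_top_iff hc).2 hv.1, fun y hy => ?_⟩
  have := hv.2 y ((hf.const_mul_ne_top_iff hc).1 hy)
  simp only [EReal.toReal_mul, EReal.toReal_coe, real_inner_smul_left]
  nlinarith

theorem indicator_add_ne_top_iff (hf : Gamma0 f) {C : Set H} {y : H} :
    indicator C y + f y ≠ ⊤ ↔ y ∈ C ∧ f y ≠ ⊤ := by
  by_cases hy : y ∈ C
  · simp [indicator, hy]
  · simp [indicator, hy, EReal.top_add_of_ne_bot (hf.ne_bot y)]

theorem Gamma0.indicator_add (hf : Gamma0 f) {C : Set H} (hC : IsClosed C) (hconv : Convex ℝ C)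
    (hne : (C ∩ dom f).Nonempty) : Gamma0 fun y => indicator C y + f y where
  ne_bot x := by
    by_cases hx : x ∈ C
    · simpa [indicator, hx] using hf.ne_bot x
    · simp [indicator, hx, EReal.top_add_of_ne_bot (hf.ne_bot x)]
  proper := by
    obtain ⟨x, hx, hx'⟩ := hne
    exact ⟨x, (indicator_add_ne_top_iff hf).2 ⟨hx, ne_of_lt hx'⟩⟩
  lsc := by
    refine lowerSemicontinuous_iff_isClosed_preimage.2 fun a => ?_
    rcases eq_or_ne a ⊤ with rfl | ha
    · simp
    convert hC.inter (lowerSemicontinuous_iff_isClosed_preimage.1 hf.lsc a) using 1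
    ext y
    by_cases hy : y ∈ C
    · simp [indicator, hy]
    · simp [indicator, hy, EReal.top_add_of_ne_bot (hf.ne_bot y), ha]
  convex x y a b ha hb hab := by
    have hbot : ∀ (c : ℝ), 0 < c → ∀ z, (c : EReal) * (indicator C z + f z) ≠ ⊥ := by
      intro c hc z
      by_cases hz : z ∈ C
      · simpa [indicator, hz] using (hf.const_mul hc).ne_bot z
      · simp [indicator, hz, EReal.top_add_of_ne_bot (hf.ne_bot z), EReal.coe_mul_top_of_pos hc]
    by_cases hx : x ∈ C
    · by_cases hy : y ∈ C
      · have hxy := hconv hx hy ha.le hb.le hab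
        rw [indicator_add_of_mem hx, indicator_add_of_mem hy, indicator_add_of_mem hxy]
        exact hf.convex x y a b ha hb hab
      · have : (b : EReal) * (indicator C y + f y) = ⊤ := by
          simp [indicator, hy, EReal.top_add_of_ne_bot (hf.ne_bot y), EReal.coe_mul_top_of_pos hb]
        rw [this, EReal.add_top_of_ne_bot (hbot a ha x)]
        exact le_top
    · have : (a : EReal) * (indicator C x + f x) = ⊤ := by
        simp [indicator, hx, EReal.top_add_of_ne_bot (hf.ne_bot x), EReal.coe_mul_top_of_pos ha]
      rw [this, EReal.top_add_of_ne_bot (hbot b hb y)]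
      exact le_top

/-! ### Proximal points -/

theorem Gamma0.proxObjective_eq_coe (hh : Gamma0 h) (x : H) {y : H} (hy : h y ≠ ⊤) :
    proxObjective h x y = ((1 / 2 * ‖y - x‖ ^ 2 + (h y).toReal : ℝ) : EReal) := by
  rw [proxObjective, EReal.coe_add, hh.coe_toReal hy]

theorem Gamma0.isProxPoint_iff_toReal (hh : Gamma0 h) {x p : H} :
    IsProxPoint h x p ↔ h p ≠ ⊤ ∧ ∀ y, h y ≠ ⊤ →
      1 / 2 * ‖p - x‖ ^ 2 + (h p).toReal ≤ 1 / 2 * ‖y - x‖ ^ 2 + (h y).toReal := by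
  constructor
  · intro hp
    have hp' : h p ≠ ⊤ := by
      intro htop
      obtain ⟨y, hy⟩ := hh.proper
      have := hp y
      rw [proxObjective_eq_top x htop, hh.proxObjective_eq_coe x hy, top_le_iff] at this
      exact EReal.coe_ne_top _ this
    refine ⟨hp', fun y hy => ?_⟩
    have := hp y
    rwa [hh.proxObjective_eq_coe x hp', hh.proxObjective_eq_coe x hy, EReal.coe_le_coe_iff] at this
  · rintro ⟨hp, H⟩ y
    by_cases hy : h y = ⊤
    · rw [proxObjective_eq_top x hy]
      exact le_top
    · rw [hh.proxObjective_eq_coe x hp, hh.proxObjective_eq_coe x hy, EReal.coe_le_coe_iff]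
      exact H y hy

theorem half_sq_norm_add (a b : H) :
    1 / 2 * ‖a + b‖ ^ 2 = 1 / 2 * ‖a‖ ^ 2 + ⟪a, b⟫ + 1 / 2 * ‖b‖ ^ 2 := by
  rw [norm_add_sq_real]
  ring

/-- Fermat's rule for the proximal point: `p` minimizes `½‖· - x‖² + h` if and only if `x - p` is a
subgradient of `h` at `p`. -/
theorem Gamma0.isProxPoint_iff (hh : Gamma0 h) {x p : H} :
    IsProxPoint h x p ↔ IsSubgradientAt h p (x - p) := by
  rw [hh.isProxPoint_iff_toReal]
  refine and_congr_right fun hp => ⟨fun H y hy => ?_, fun H y hy => ?_⟩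
  · rw [← sub_nonpos]
    refine le_zero_of_forall_le_mul (b := 1 / 2 * ‖y - p‖ ^ 2) fun t ht0 ht1 => ?_
    have hp' : p ∈ dom h := lt_top_iff_ne_top.2 hp
    have hy' : y ∈ dom h := lt_top_iff_ne_top.2 hy
    have h1 : 0 < 1 - t := by linarith
    have hmem := hh.convexOn.1 hp' hy' h1.le ht0.le (by ring)
    have hle := hh.convexOn.2 hp' hy' h1.le ht0.le (by ring)
    have hmin := H _ (ne_of_lt hmem)
    have heq : (1 - t) • p + t • y - x = (p - x) + t • (y - p) := by module
    rw [heq, half_sq_norm_add, norm_smul, real_inner_smul_right, Real.norm_of_nonneg ht0.le] at hmin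
    simp only [smul_eq_mul] at hle
    have hneg : ⟪x - p, y - p⟫ = -⟪p - x, y - p⟫ := by rw [← inner_neg_left, neg_sub]
    rw [hneg]
    refine le_of_mul_le_mul_left ?_ ht0
    nlinarith
  · have h1 := H y hy
    have heq : y - x = (p - x) + (y - p) := by abel
    have hneg : ⟪x - p, y - p⟫ = -⟪p - x, y - p⟫ := by rw [← inner_neg_left, neg_sub]
    rw [hneg] at h1
    rw [heq, half_sq_norm_add]
    nlinarith [sq_nonneg ‖y - p‖]

/-- Subgradients are monotone. -/
theorem IsSubgradientAt.inner_nonneg {p q u v : H} (hp : IsSubgradientAt h p u)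
    (hq : IsSubgradientAt h q v) : 0 ≤ ⟪u - v, p - q⟫ := by
  have h1 := hp.2 q hq.1
  have h2 := hq.2 p hp.1
  have : ⟪u, q - p⟫ = -⟪u, p - q⟫ := by rw [← inner_neg_right, neg_sub]
  rw [inner_sub_left]
  linarith

theorem Gamma0.isProxPoint_unique (hh : Gamma0 h) {x p q : H} (hp : IsProxPoint h x p)
    (hq : IsProxPoint h x q) : p = q := by
  have := (hh.isProxPoint_iff.1 hp).inner_nonneg (hh.isProxPoint_iff.1 hq)
  have heq : x - p - (x - q) = -(p - q) := by abel
  rw [heq, inner_neg_left, real_inner_self_eq_norm_sq] at this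
  have h0 : ‖p - q‖ = 0 := by nlinarith [sq_nonneg ‖p - q‖]
  exact sub_eq_zero.1 (norm_eq_zero.1 h0)

/-- A function in `Γ₀` decreases at most linearly at infinity. Lower semicontinuity bounds it below
on a ball around a point of its domain, and convexity propagates the bound along rays. -/
theorem Gamma0.exists_linear_lower_bound (hh : Gamma0 h) (x : H) :
    ∃ a b : ℝ, ∀ y, h y ≠ ⊤ → a - b * ‖y - x‖ ≤ (h y).toReal := by
  obtain ⟨x₀, hx₀⟩ := hh.proper
  set F : H → ℝ := fun y => (h y).toReal with hF
  have hlt : ((F x₀ - 1 : ℝ) : EReal) < h x₀ := by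
    rw [← hh.coe_toReal hx₀, EReal.coe_lt_coe_iff]
    exact sub_one_lt _
  obtain ⟨r, hr, hball⟩ := Metric.eventually_nhds_iff.1 (hh.lsc x₀ _ hlt)
  have hball' : ∀ y, h y ≠ ⊤ → ‖y - x₀‖ < r → F x₀ - 1 < F y := by
    intro y hy hyr
    have := hball (y := y) (by rwa [dist_eq_norm])
    change _ < h y at this
    rwa [← hh.coe_toReal hy, EReal.coe_lt_coe_iff] at this
  have main : ∀ y, h y ≠ ⊤ → F x₀ - 1 - 2 / r * ‖y - x₀‖ ≤ F y := by
    intro y hy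
    by_cases hyr : ‖y - x₀‖ < r
    · have : 0 ≤ 2 / r * ‖y - x₀‖ := by positivity
      linarith [hball' y hy hyr]
    · rw [not_lt] at hyr
      have hpos : 0 < ‖y - x₀‖ := hr.trans_le hyr
      -- The point at distance `r / 2` from `x₀` on the segment from `x₀` to `y`.
      set t := r / (2 * ‖y - x₀‖) with ht
      have ht0 : 0 < t := by positivity
      have htN : t * ‖y - x₀‖ = r / 2 := by rw [ht]; field_simp
      have ht1 : t ≤ 1 := by
        by_contra hcon
        push Not at hcon
        nlinarith
      have hx' : x₀ ∈ dom h := lt_top_iff_ne_top.2 hx₀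
      have hy' : y ∈ dom h := lt_top_iff_ne_top.2 hy
      have hmem := hh.convexOn.1 hx' hy' (sub_nonneg.2 ht1) ht0.le (by ring)
      have hle := hh.convexOn.2 hx' hy' (sub_nonneg.2 ht1) ht0.le (by ring)
      have hb := hball' _ (ne_of_lt hmem) (by
        have : (1 - t) • x₀ + t • y - x₀ = t • (y - x₀) := by module
        rw [this, norm_smul, Real.norm_of_nonneg ht0.le, htN]
        linarith)
      simp only [smul_eq_mul] at hle
      have h1 : t * (F x₀ - F y) ≤ t * (2 / r * ‖y - x₀‖) := by
        have : t * (2 / r * ‖y - x₀‖) = 1 := by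
          rw [mul_left_comm, htN]
          field_simp
        rw [this]
        simp only [hF] at hb ⊢
        linarith
      linarith [le_of_mul_le_mul_left h1 ht0]
  refine ⟨F x₀ - 1 - 2 / r * ‖x - x₀‖, 2 / r, fun y hy => ?_⟩
  have h1 : ‖y - x₀‖ ≤ ‖y - x‖ + ‖x - x₀‖ := norm_sub_le_norm_sub_add_norm_sub ..
  have h2 : 2 / r * ‖y - x₀‖ ≤ 2 / r * (‖y - x‖ + ‖x - x₀‖) :=
    mul_le_mul_of_nonneg_left h1 (by positivity)
  have := main y hy
  simp only [hF] at this ⊢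
  linarith

/-- Minimizing sequences of the strongly convex objective are Cauchy, by the parallelogram law, and
lower semicontinuity makes their limit a minimizer. -/
theorem Gamma0.exists_isProxPoint [CompleteSpace H] (hh : Gamma0 h) (x : H) :
    ∃ p, IsProxPoint h x p := by
  set F : H → ℝ := fun y => 1 / 2 * ‖y - x‖ ^ 2 + (h y).toReal with hF
  obtain ⟨a, b, hab⟩ := hh.exists_linear_lower_bound x
  obtain ⟨x₀, hx₀⟩ := hh.proper
  have hne : (F '' dom h).Nonempty := ⟨F x₀, x₀, lt_top_iff_ne_top.2 hx₀, rfl⟩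
  have hbdd : BddBelow (F '' dom h) := by
    refine ⟨a - b ^ 2 / 2, ?_⟩
    rintro _ ⟨y, hy, rfl⟩
    have := hab y (ne_of_lt hy)
    simp only [hF]
    nlinarith [sq_nonneg (‖y - x‖ - b)]
  set μ := sInf (F '' dom h) with hμ
  have hμle : ∀ y ∈ dom h, μ ≤ F y := fun y hy => csInf_le hbdd ⟨y, hy, rfl⟩
  have hex : ∀ n : ℕ, ∃ y ∈ dom h, F y < μ + 1 / ((n : ℝ) + 1) := by
    intro n
    obtain ⟨_, ⟨y, hy, rfl⟩, hlt⟩ := exists_lt_of_csInf_lt hne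
      (show sInf (F '' dom h) < μ + 1 / ((n : ℝ) + 1) from lt_add_of_pos_right _ (by positivity))
    exact ⟨y, hy, hlt⟩
  choose y hy hylt using hex
  have hpar : ∀ u ∈ dom h, ∀ v ∈ dom h, ‖u - v‖ ^ 2 ≤ 4 * (F u + F v - 2 * μ) := by
    intro u hu v hv
    have hmem := hh.convexOn.1 hu hv (by norm_num : (0 : ℝ) ≤ 1 / 2)
      (by norm_num : (0 : ℝ) ≤ 1 / 2) (by norm_num)
    have hle := hh.convexOn.2 hu hv (by norm_num : (0 : ℝ) ≤ 1 / 2)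
      (by norm_num : (0 : ℝ) ≤ 1 / 2) (by norm_num)
    have hm := hμle _ hmem
    have h1 := parallelogram_law_with_norm ℝ (u - x) (v - x)
    have h2 : u - x - (v - x) = u - v := by abel
    have h3 : ((1 / 2 : ℝ) • u + (1 / 2 : ℝ) • v) - x = (1 / 2 : ℝ) • ((u - x) + (v - x)) := by
      module
    simp only [hF, smul_eq_mul] at hm hle ⊢
    rw [h3, norm_smul, Real.norm_of_nonneg (by norm_num : (0 : ℝ) ≤ 1 / 2)] at hm
    rw [h2] at h1
    nlinarith
  have hcauchy : CauchySeq y := by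
    refine Metric.cauchySeq_iff'.2 fun ε hε => ?_
    obtain ⟨N, hN⟩ := exists_nat_one_div_lt (show 0 < ε ^ 2 / 8 by positivity)
    refine ⟨N, fun n hn => ?_⟩
    rw [dist_eq_norm]
    have h1 := hpar _ (hy n) _ (hy N)
    have h2 : (1 : ℝ) / ((n : ℝ) + 1) ≤ 1 / ((N : ℝ) + 1) := by
      apply one_div_le_one_div_of_le (by positivity)
      have : (N : ℝ) ≤ n := by exact_mod_cast hn
      linarith
    have h3 := hylt n
    have h4 := hylt N
    refine lt_of_pow_lt_pow_left₀ 2 hε.le ?_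
    linarith
  obtain ⟨p, hp⟩ := cauchySeq_tendsto_of_complete hcauchy
  -- The limit is in every sublevel set above the infimum.
  have hlim : ∀ c : ℝ, μ < c → h p ≤ ((c - 1 / 2 * ‖p - x‖ ^ 2 : ℝ) : EReal) := by
    intro c hc
    by_contra hcon
    obtain ⟨s, hs1, hs2⟩ := EReal.lt_iff_exists_real_btwn.1 (not_le.1 hcon)
    have hev := hp.eventually (hh.lsc p _ hs2)
    have hs3 : c - 1 / 2 * ‖p - x‖ ^ 2 < s := EReal.coe_lt_coe_iff.1 hs1
    have ht1 : Tendsto (fun n => 1 / 2 * ‖y n - x‖ ^ 2 + s) atTop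
        (𝓝 (1 / 2 * ‖p - x‖ ^ 2 + s)) :=
      ((((hp.sub_const x).norm).pow 2).const_mul _).add_const _
    have ht2 : Tendsto (fun n : ℕ => μ + 1 / ((n : ℝ) + 1)) atTop (𝓝 (μ + 0)) :=
      tendsto_one_div_add_atTop_nhds_zero_nat.const_add μ
    have hle : 1 / 2 * ‖p - x‖ ^ 2 + s ≤ μ + 0 := by
      refine le_of_tendsto_of_tendsto ht1 ht2 ?_
      filter_upwards [hev] with n hn
      change _ < h (y n) at hn
      rw [← hh.coe_toReal (ne_of_lt (hy n)), EReal.coe_lt_coe_iff] at hn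
      have := hylt n
      simp only [hF] at this
      linarith
    linarith
  have hptop : h p ≠ ⊤ :=
    ne_of_lt ((hlim (μ + 1) (by linarith)).trans_lt (EReal.coe_lt_top _))
  refine ⟨p, hh.isProxPoint_iff_toReal.2 ⟨hptop, fun z hz => ?_⟩⟩
  refine le_trans (le_of_forall_gt_imp_ge_of_dense fun c hc => ?_)
    (hμle z (lt_top_iff_ne_top.2 hz))
  have := hlim c hc
  rw [← hh.coe_toReal hptop, EReal.coe_le_coe_iff] at this
  linarith

theorem Gamma0.isProxPoint_prox [CompleteSpace H] (hh : Gamma0 h) (x : H) :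
    IsProxPoint h x (prox h x) := by
  have hex := hh.exists_isProxPoint x
  rw [prox, dif_pos hex]
  exact hex.choose_spec

theorem Gamma0.prox_eq [CompleteSpace H] (hh : Gamma0 h) {x p : H} (hp : IsProxPoint h x p) :
    prox h x = p :=
  hh.isProxPoint_unique (hh.isProxPoint_prox x) hp

/-- The projection onto a nonempty closed convex set satisfies the obtuse angle inequality. -/
theorem proj_mem_and_inner_le_zero [CompleteSpace H] {C : Set H} (hne : C.Nonempty)
    (hC : IsClosed C) (hconv : Convex ℝ C) (x : H) :
    proj C x ∈ C ∧ ∀ q ∈ C, ⟪x - proj C x, q - proj C x⟫ ≤ 0 := by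
  have key : ∀ p ∈ C, (‖x - p‖ = ⨅ w : C, ‖x - w‖) ↔ IsNearest C x p := by
    intro p hp
    have hbdd : BddBelow (Set.range fun w : C => ‖x - w‖) := by
      refine ⟨0, ?_⟩
      rintro _ ⟨w, rfl⟩
      exact norm_nonneg _
    have : Nonempty C := hne.to_subtype
    refine ⟨fun h => ⟨hp, fun q hq => h ▸ ciInf_le hbdd ⟨q, hq⟩⟩, fun h => ?_⟩
    exact le_antisymm (le_ciInf fun w => h.2 w w.2) (ciInf_le hbdd ⟨p, hp⟩)
  have hex : ∃ p, IsNearest C x p := by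
    obtain ⟨p, hp, hpx⟩ := exists_norm_eq_iInf_of_complete_convex hne hC.isComplete hconv x
    exact ⟨p, (key p hp).1 hpx⟩
  have hnear : IsNearest C x (proj C x) := by
    rw [proj, dif_pos hex]
    exact hex.choose_spec
  exact ⟨hnear.1, (norm_eq_iInf_iff_real_inner_le_zero hconv hnear.1).1 ((key _ hnear.1).2 hnear)⟩

end Basic

/-! ### Proper separation of a convex set from the origin -/

section Separation

variable {E : Type*} [NormedAddCommGroup E] [NormedSpace ℝ E]

theorem exists_nonneg_ne_zero_of_interior_nonempty {D : Set E} (hD : Convex ℝ D)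
    (h0 : (0 : E) ∉ D) (hint : (interior D).Nonempty) :
    ∃ ψ : E →L[ℝ] ℝ, (∀ d ∈ D, 0 ≤ ψ d) ∧ ∃ d ∈ D, ψ d ≠ 0 := by
  obtain ⟨ψ, hψ⟩ := geometric_hahn_banach_point_open hD.interior isOpen_interior
    fun h => h0 (interior_subset h)
  simp only [map_zero] at hψ
  refine ⟨ψ, fun d hd => ?_, ?_⟩
  · have hmem : d ∈ closure (interior D) := by
      rw [hD.closure_interior_eq_closure_of_nonempty_interior hint]
      exact subset_closure hd
    have hcl : IsClosed {e | 0 ≤ ψ e} := isClosed_le continuous_const ψ.continuous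
    exact closure_minimal (fun e he => (hψ e he).le) hcl hmem
  · obtain ⟨d, hd⟩ := hint
    exact ⟨d, interior_subset hd, (hψ d hd).ne'⟩

/-- In finite dimension no interior is needed: the cone generated by `D` misses the origin and has
nonempty interior in the linear span of `D`. -/
theorem exists_nonneg_ne_zero_of_finiteDimensional [FiniteDimensional ℝ E] {D : Set E}
    (hD : Convex ℝ D) (hne : D.Nonempty) (h0 : (0 : E) ∉ D) :
    ∃ ψ : E →L[ℝ] ℝ, (∀ d ∈ D, 0 ≤ ψ d) ∧ ∃ d ∈ D, ψ d ≠ 0 := by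
  set W := Submodule.span ℝ D with hW
  have hcone : ∀ e, e ∈ ConvexCone.hull ℝ D ↔ ∃ t : ℝ, 0 < t ∧ ∃ d ∈ D, t • d = e := fun e =>
    ConvexCone.mem_hull_of_convex hD
  set K : Set W := W.subtype ⁻¹' (ConvexCone.hull ℝ D : Set E) with hK
  have hKconv : Convex ℝ K := (ConvexCone.hull ℝ D).convex.linear_preimage W.subtype
  have hDK : ((↑) ⁻¹' D : Set W) ⊆ K := fun w hw => ConvexCone.subset_hull hw
  have hK0 : (0 : W) ∉ K := by
    intro h
    obtain ⟨t, ht, d, hd, htd⟩ := (hcone _).1 h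
    have : d = 0 := by simpa [ht.ne'] using htd
    exact h0 (this ▸ hd)
  have hKne : K.Nonempty := by
    obtain ⟨d, hd⟩ := hne
    exact ⟨⟨d, Submodule.subset_span hd⟩, hDK hd⟩
  have hKint : (interior K).Nonempty := by
    rw [hKconv.interior_nonempty_iff_affineSpan_eq_top,
      AffineSubspace.affineSpan_eq_top_iff_vectorSpan_eq_top_of_nonempty _ _ _ hKne, eq_top_iff,
      ← Submodule.span_span_coe_preimage, Submodule.span_le]
    intro w hw
    have h1 : w ∈ K := hDK hw
    have h2 : (2 : ℝ) • w ∈ K := (ConvexCone.hull ℝ D).smul_mem two_pos h1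
    have := vsub_mem_vectorSpan ℝ h2 h1
    have heq : (2 : ℝ) • w -ᵥ w = w := by
      rw [vsub_eq_sub]
      module
    rwa [heq] at this
  obtain ⟨ψ, hψ, k, hk, hψk⟩ := exists_nonneg_ne_zero_of_interior_nonempty hKconv hK0 hKint
  obtain ⟨φ, hφ, -⟩ := exists_extension_norm_eq W ψ
  refine ⟨φ, fun d hd => ?_, ?_⟩
  · have := hψ ⟨d, Submodule.subset_span hd⟩ (hDK hd)
    rwa [← hφ] at this
  · obtain ⟨t, ht, d, hd, htd⟩ := (hcone _).1 hk
    refine ⟨d, hd, fun h => hψk ?_⟩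
    rw [← hφ, show (k : E) = t • d from htd.symm, map_smul, h, smul_zero]

end Separation

/-! ### The subdifferential sum rule for an indicator function -/

/-- By Baire's theorem, a lower semicontinuous function is bounded above on some ball as soon as its
domain has an interior point. -/
theorem exists_isOpen_forall_le {H : Type*} [NormedAddCommGroup H] [CompleteSpace H]
    {f : H → EReal} (hf : LowerSemicontinuous f)
    (hne : (interior (dom f)).Nonempty) :
    ∃ (U : Set H) (n : ℕ), IsOpen U ∧ U.Nonempty ∧ ∀ y ∈ U, f y ≤ (n : ℝ) := by
  let F : ℕ → Set H := fun n => {y | f y ≤ (n : ℝ)} ∪ (interior (dom f))ᶜ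
  have hclosed : ∀ n, IsClosed (F n) := fun n =>
    (lowerSemicontinuous_iff_isClosed_preimage.1 hf _).union isOpen_interior.isClosed_compl
  have hcover : ⋃ n, F n = Set.univ := by
    refine Set.eq_univ_of_forall fun y => ?_
    by_cases hy : y ∈ interior (dom f)
    · obtain ⟨n, hn⟩ := exists_nat_ge (f y).toReal
      refine Set.mem_iUnion.2 ⟨n, Or.inl ?_⟩
      have h1 : f y ≤ (f y).toReal := EReal.le_coe_toReal (ne_of_lt (interior_subset (s := dom f) hy))
      exact h1.trans (EReal.coe_le_coe_iff.2 hn)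
    · exact Set.mem_iUnion.2 ⟨0, Or.inr hy⟩
  obtain ⟨y, hy, hyF⟩ := (dense_iUnion_interior_of_closed hclosed hcover).inter_open_nonempty _
    isOpen_interior hne
  obtain ⟨n, hn⟩ := Set.mem_iUnion.1 hyF
  refine ⟨interior (dom f) ∩ interior (F n), n, isOpen_interior.inter isOpen_interior,
    ⟨y, hy, hn⟩, fun z hz => ?_⟩
  exact (interior_subset hz.2).resolve_right fun h => h hz.1

section SumRule

variable {H : Type*} [NormedAddCommGroup H] [InnerProductSpace ℝ H] {f : H → EReal}

/-- A point of the relative interior of a set can be moved slightly within the set, away from any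
other point of the set. -/
theorem eventually_sub_smul_mem_of_mem_intrinsicInterior {S : Set H} {c y : H}
    (hc : c ∈ intrinsicInterior ℝ S) (hy : y ∈ S) :
    ∀ᶠ ε in 𝓝[>] (0 : ℝ), c - ε • (y - c) ∈ S := by
  obtain ⟨c', hc', rfl⟩ := mem_intrinsicInterior.1 hc
  set y' : affineSpan ℝ S := ⟨y, subset_affineSpan ℝ S hy⟩
  have hmem : ∀ ε : ℝ, (c' : H) - ε • (y - c') ∈ affineSpan ℝ S := by
    intro ε
    have := AffineMap.lineMap_mem (-ε) c'.2 y'.2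
    rw [AffineMap.lineMap_apply_module'] at this
    convert this using 1
    module
  let g : ℝ → affineSpan ℝ S := fun ε => ⟨(c' : H) - ε • (y - c'), hmem ε⟩
  have hg : Continuous g := by
    refine Continuous.subtype_mk ?_ _
    fun_prop
  have hg0 : g 0 = c' := Subtype.ext (by simp [g])
  have hev : ∀ᶠ ε in 𝓝 (0 : ℝ), g ε ∈ interior ((↑) ⁻¹' S : Set (affineSpan ℝ S)) :=
    hg.continuousAt.eventually_mem (by rw [hg0]; exact isOpen_interior.mem_nhds hc')
  filter_upwards [nhdsWithin_le_nhds hev] with ε hε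
  exact interior_subset (s := ((↑) ⁻¹' S : Set (affineSpan ℝ S))) hε

theorem eventually_add_smul_mem_of_mem_interior {S : Set H} {c : H} (hc : c ∈ interior S) (w : H) :
    ∀ᶠ ε in 𝓝[>] (0 : ℝ), c + ε • w ∈ S := by
  have hg : Continuous fun ε : ℝ => c + ε • w := by fun_prop
  have hev : ∀ᶠ ε in 𝓝 (0 : ℝ), c + ε • w ∈ interior S :=
    hg.continuousAt.eventually_mem (by simpa using isOpen_interior.mem_nhds hc)
  filter_upwards [nhdsWithin_le_nhds hev] with ε hε
  exact interior_subset hε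

/-- The constraint qualification relating the set `C` and the domain of `f`. -/
def Qualified (C : Set H) (f : H → EReal) : Prop :=
  (C ∩ interior (dom f)).Nonempty ∨ (dom f ∩ interior C).Nonempty ∨
    (FiniteDimensional ℝ H ∧ (intrinsicInterior ℝ C ∩ intrinsicInterior ℝ (dom f)).Nonempty)

theorem Qualified.inter_nonempty {C : Set H} (hq : Qualified C f) : (C ∩ dom f).Nonempty := by
  obtain ⟨c, h1, h2⟩ | ⟨c, h1, h2⟩ | ⟨-, c, h1, h2⟩ := hq
  · exact ⟨c, h1, interior_subset h2⟩
  · exact ⟨c, interior_subset h2, h1⟩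
  · exact ⟨c, intrinsicInterior_subset h1, intrinsicInterior_subset h2⟩

/-- What the three qualifications have in common: the cone generated by `dom f - C` is a linear
subspace, as it contains the opposite of each of its elements. -/
theorem Qualified.exists_neg_smul_mem {C : Set H} (hq : Qualified C f) {y c : H} (hy : y ∈ dom f)
    (hc : c ∈ C) : ∃ ε : ℝ, 0 < ε ∧ ∃ y' ∈ dom f, ∃ c' ∈ C, y' - c' = -(ε • (y - c)) := by
  obtain ⟨p, h1, h2⟩ | ⟨p, h1, h2⟩ | ⟨-, p, h1, h2⟩ := hq
  · obtain ⟨ε, hε, hε0⟩ := ((eventually_add_smul_mem_of_mem_interior h2 (-(y - c))).and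
      self_mem_nhdsWithin).exists
    exact ⟨ε, hε0, _, hε, p, h1, by module⟩
  · obtain ⟨ε, hε, hε0⟩ := ((eventually_add_smul_mem_of_mem_interior h2 (y - c)).and
      self_mem_nhdsWithin).exists
    exact ⟨ε, hε0, p, h1, _, hε, by module⟩
  · obtain ⟨ε, ⟨hε1, hε2⟩, hε0⟩ := (((eventually_sub_smul_mem_of_mem_intrinsicInterior h2 hy).and
      (eventually_sub_smul_mem_of_mem_intrinsicInterior h1 hc)).and self_mem_nhdsWithin).exists
    exact ⟨ε, hε0, _, hε1, _, hε2, by module⟩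

/-- Sum rule for `ι_C + f`: a subgradient splits into a normal to `C` and a subgradient of `f`. The
epigraph of `f`, tilted by the subgradient, is separated from the cylinder `C × ]-∞, 0[`, and the
qualification prevents the separating hyperplane from being vertical. -/
theorem Gamma0.exists_normal_add_subgradient [CompleteSpace H] (hf : Gamma0 f) {C : Set H}
    (hconv : Convex ℝ C) (hq : Qualified C f) {p ℓ : H}
    (hp : IsSubgradientAt (fun y => indicator C y + f y) p ℓ) :
    ∃ u, p ∈ C ∧ (∀ y ∈ C, ⟪u, y - p⟫ ≤ 0) ∧ IsSubgradientAt f p (ℓ - u) := by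
  obtain ⟨hpC, hpf⟩ := (indicator_add_ne_top_iff hf).1 hp.1
  have hℓ : ∀ y ∈ C, y ∈ dom f → (f p).toReal + ⟪ℓ, y - p⟫ ≤ (f y).toReal := by
    intro y hyC hyf
    have := hp.2 y ((indicator_add_ne_top_iff hf).2 ⟨hyC, ne_of_lt hyf⟩)
    simpa only [indicator_add_of_mem hpC, indicator_add_of_mem hyC] using this
  set G : H → ℝ := fun y => (f y).toReal - (f p).toReal - ⟪ℓ, y - p⟫ with hG
  have hGp : G p = 0 := by simp [hG]
  set A : Set (H × ℝ) := {q | q.1 ∈ dom f ∧ G q.1 ≤ q.2} with hA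
  set B : Set (H × ℝ) := C ×ˢ Set.Iio 0 with hB
  have hpdom : p ∈ dom f := lt_top_iff_ne_top.2 hpf
  have hpA : (p, (0 : ℝ)) ∈ A := ⟨hpdom, hGp.le⟩
  have hpB : (p, (-1 : ℝ)) ∈ B := ⟨hpC, by simp⟩
  have hGconv : ConvexOn ℝ (dom f) G := by
    refine convexOn_iff_forall_pos.2 ⟨hf.convexOn.1, fun y hy z hz a b ha hb hab => ?_⟩
    have h1 := hf.convexOn.2 hy hz ha.le hb.le hab
    have h2 : a • y + b • z - p = a • (y - p) + b • (z - p) := by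
      rw [smul_sub, smul_sub, sub_add_sub_comm, ← add_smul, hab, one_smul]
    simp only [hG, smul_eq_mul] at h1 ⊢
    rw [h2, inner_add_right, real_inner_smul_right, real_inner_smul_right]
    linear_combination h1 + (f p).toReal * hab
  have hDconv : Convex ℝ (A - B) := hGconv.convex_epigraph.sub (hconv.prod (convex_Iio 0))
  have hD0 : (0 : H × ℝ) ∉ A - B := by
    rintro ⟨⟨y, s⟩, ⟨hy, hys⟩, ⟨z, t⟩, ⟨hz, ht⟩, hyz⟩
    obtain ⟨h1, h2⟩ := Prod.mk.inj (sub_eq_zero.1 hyz)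
    subst h1 h2
    have := hℓ y hz hy
    simp only [hG, Set.mem_Iio] at hys ht
    linarith
  have hsep : ∃ ψ : (H × ℝ) →L[ℝ] ℝ, (∀ d ∈ A - B, 0 ≤ ψ d) ∧ ∃ d ∈ A - B, ψ d ≠ 0 := by
    have hint_left : (interior A).Nonempty → (interior (A - B)).Nonempty := by
      rintro ⟨a, ha⟩
      exact ⟨a - (p, -1), subset_interior_sub_left (Set.sub_mem_sub ha hpB)⟩
    obtain ⟨c, h1, h2⟩ | ⟨c, h1, h2⟩ | ⟨hfin, -⟩ := hq
    · refine exists_nonneg_ne_zero_of_interior_nonempty hDconv hD0 (hint_left ?_)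
      obtain ⟨U, n, hU, ⟨u, hu⟩, hUn⟩ := exists_isOpen_forall_le hf.lsc ⟨c, h2⟩
      let V : Set (H × ℝ) := {q | q.1 ∈ U} ∩ {q | n - (f p).toReal - ⟪ℓ, q.1 - p⟫ < q.2}
      have hV : IsOpen V := (hU.preimage continuous_fst).inter
        (isOpen_lt (by fun_prop) (by fun_prop))
      refine ⟨(u, n - (f p).toReal - ⟪ℓ, u - p⟫ + 1), interior_maximal ?_ hV ⟨hu, ?_⟩⟩
      · rintro ⟨y, t⟩ ⟨hy, hyt⟩
        have hyn := hUn y hy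
        have hydom : y ∈ dom f := hyn.trans_lt (EReal.coe_lt_top _)
        rw [← hf.coe_toReal (ne_of_lt hydom), EReal.coe_le_coe_iff] at hyn
        refine ⟨hydom, ?_⟩
        simp only [hG, Set.mem_ofPred_eq] at hyt ⊢
        linarith
      · exact lt_add_one ((n : ℝ) - (f p).toReal - ⟪ℓ, u - p⟫)
    · refine exists_nonneg_ne_zero_of_interior_nonempty hDconv hD0 ?_
      have hc : (c, (-1 : ℝ)) ∈ interior B := by
        rw [hB, interior_prod_eq, isOpen_Iio.interior_eq]
        exact ⟨h2, by simp⟩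
      exact ⟨(p, 0) - (c, -1), subset_interior_sub_right (Set.sub_mem_sub hpA hc)⟩
    · exact exists_nonneg_ne_zero_of_finiteDimensional hDconv ⟨_, Set.sub_mem_sub hpA hpB⟩ hD0
  obtain ⟨ψ, hψ, hψne⟩ := hsep
  set φ : H →L[ℝ] ℝ := ψ.comp (ContinuousLinearMap.inl ℝ H ℝ) with hφ
  set s : ℝ := ψ (0, 1) with hs
  have hψeq : ∀ (y : H) (t : ℝ), ψ (y, t) = φ y + t * s := by
    intro y t
    have : (y, t) = (y, (0 : ℝ)) + t • ((0 : H), (1 : ℝ)) := by simp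
    rw [this, map_add, map_smul, smul_eq_mul]
    rfl
  have hineq : ∀ y ∈ dom f, ∀ c ∈ C, ∀ r, 0 < r → 0 ≤ φ (y - c) + (G y + r) * s := by
    intro y hy c hc r hr
    rw [← hψeq]
    refine hψ _ ?_
    have : (y - c, G y + r) = (y, G y) - (c, -r) := by simp
    rw [this]
    exact Set.sub_mem_sub ⟨hy, le_rfl⟩ ⟨hc, by simpa using hr⟩
  have hs0 : 0 ≤ s := by
    have := hineq p hpdom p hpC 1 one_pos
    simpa [hGp] using this
  have hspos : 0 < s := by
    refine hs0.lt_of_ne' fun hsz => ?_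
    have hφ0 : ∀ y ∈ dom f, ∀ c ∈ C, 0 ≤ φ (y - c) := by
      intro y hy c hc
      simpa [hsz] using hineq y hy c hc 1 one_pos
    obtain ⟨d, ⟨⟨y, t⟩, ⟨hy, -⟩, ⟨c, t'⟩, ⟨hc, -⟩, rfl⟩, hd⟩ := hψne
    apply hd
    change ψ (y - c, t - t') = 0
    rw [hψeq, hsz, mul_zero, add_zero]
    refine le_antisymm ?_ (hφ0 y hy c hc)
    obtain ⟨ε, hε, y', hy', c', hc', heq⟩ := hq.exists_neg_smul_mem hy hc
    have := hφ0 y' hy' c' hc'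
    rw [heq, map_neg, map_smul, smul_eq_mul] at this
    nlinarith
  have hineq' : ∀ y ∈ dom f, ∀ c ∈ C, 0 ≤ φ (y - c) + G y * s := by
    intro y hy c hc
    refine le_of_forall_pos_le_add fun e he => ?_
    have := hineq y hy c hc (e / s) (div_pos he hspos)
    rwa [add_mul, div_mul_cancel₀ _ hspos.ne', ← add_assoc] at this
  -- The normal vector represents the horizontal part of the functional, scaled by `s`.
  set w : H := (InnerProductSpace.toDual ℝ H).symm φ with hw
  have hwφ : ∀ y, ⟪w, y⟫ = φ y := fun y => InnerProductSpace.toDual_symm_apply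
  refine ⟨s⁻¹ • w, hpC, fun y hy => ?_, hpf, fun y hy => ?_⟩
  · have h1 := hineq' p hpdom y hy
    rw [hGp, zero_mul, add_zero, ← neg_sub, map_neg] at h1
    rw [real_inner_smul_left, hwφ]
    exact mul_nonpos_of_nonneg_of_nonpos (inv_nonneg.2 hs0) (by linarith)
  · have h1 := hineq' y (lt_top_iff_ne_top.2 hy) p hpC
    rw [inner_sub_left, real_inner_smul_left, hwφ]
    have h2 : 0 ≤ s⁻¹ * (φ (y - p) + G y * s) := mul_nonneg (inv_nonneg.2 hs0) h1
    rw [mul_add, mul_comm (G y), inv_mul_cancel_left₀ hspos.ne'] at h2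
    simp only [hG] at h2
    linarith

end SumRule

/-! ### Convergence of the Douglas-Rachford iteration -/

/-- If `‖d m‖²` decreases by at least a fixed multiple of `‖α m‖²` at every step, then the `‖α m‖²`
are summable, and `α` tends to zero. -/
theorem tendsto_zero_of_sq_norm_le {E : Type*} [NormedAddCommGroup E]
    {d α : ℕ → E} {c : ℝ} (hc : 0 < c)
    (h : ∀ m, ‖d (m + 1)‖ ^ 2 ≤ ‖d m‖ ^ 2 - c * ‖α m‖ ^ 2) : Tendsto α atTop (𝓝 0) := by
  have hsum : ∀ n, ∑ m ∈ Finset.range n, ‖α m‖ ^ 2 ≤ ‖d 0‖ ^ 2 / c := by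
    intro n
    have h1 : c * ∑ m ∈ Finset.range n, ‖α m‖ ^ 2 + ‖d n‖ ^ 2 ≤ ‖d 0‖ ^ 2 := by
      induction n with
      | zero => simp
      | succ n ih =>
        rw [Finset.sum_range_succ, mul_add]
        linarith [h n]
    rw [le_div_iff₀ hc]
    linarith [sq_nonneg ‖d n‖]
  have hlim := (summable_of_sum_range_le (fun m => sq_nonneg ‖α m‖) hsum).tendsto_atTop_zero
  rw [tendsto_zero_iff_norm_tendsto_zero]
  simpa using hlim.sqrt

section DouglasRachford

variable {H : Type*} [NormedAddCommGroup H] [InnerProductSpace ℝ H] {f : H → EReal}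

/-- One step of the iteration, in terms of the errors `d = z_m - z`, `α = z_{m+1/2} - p` and
`ω = prox - p`. The strong monotonicity modulus `κ` of the first operator gives a decrease that
survives at `τ = 2`, where the term in `‖ω - α‖²` is lost. -/
theorem sq_norm_add_smul_sub_le {d α ω : H} {κ t : ℝ} (ht : 0 ≤ t) (ht2 : t ≤ 2)
    (h1 : (1 + κ) * ‖α‖ ^ 2 ≤ ⟪α, d⟫) (h2 : ⟪ω, d⟫ ≤ 2 * ⟪ω, α⟫ - ‖ω‖ ^ 2) :
    ‖d + t • (ω - α)‖ ^ 2 ≤ ‖d‖ ^ 2 - 2 * t * κ * ‖α‖ ^ 2 := by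
  have h3 : ⟪d, ω - α⟫ ≤ -‖ω - α‖ ^ 2 - κ * ‖α‖ ^ 2 := by
    rw [inner_sub_right, norm_sub_sq_real, real_inner_comm ω d, real_inner_comm α d]
    linarith
  rw [norm_add_sq_real, real_inner_smul_right, norm_smul, Real.norm_of_nonneg ht, mul_pow]
  have h4 : 0 ≤ t * (2 - t) * ‖ω - α‖ ^ 2 :=
    mul_nonneg (mul_nonneg ht (sub_nonneg.2 ht2)) (sq_nonneg _)
  linarith [mul_le_mul_of_nonneg_left h3 ht]

theorem IsDouglasRachford.tendsto [CompleteSpace H] (hf : Gamma0 f) {C : Set H}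
    (hne : C.Nonempty) (hC : IsClosed C) (hconv : Convex ℝ C) {γ κ : ℝ} (hγ : 0 < γ) (hκ : 0 < κ)
    {x p u : H} (hpC : p ∈ C) (hu : ∀ y ∈ C, ⟪u, y - p⟫ ≤ 0)
    (hv : IsSubgradientAt (fun y => (γ : EReal) * f y) p (x - p - u))
    {τ : ℕ → ℝ} {c : ℝ} (hc : 0 < c) (hcτ : ∀ m, c ≤ τ m) (hτ : ∀ m, τ m ≤ 2) {z zhalf : ℕ → H}
    (hz : IsDouglasRachford C f γ κ x τ z zhalf) : Tendsto zhalf atTop (𝓝 p) := by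
  have hg : Gamma0 fun y => ((κ * γ : ℝ) : EReal) * f y := hf.const_mul (mul_pos hκ hγ)
  have hv' : IsSubgradientAt (fun y => ((κ * γ : ℝ) : EReal) * f y) p (κ • (x - p - u)) := by
    have := (hf.const_mul hγ).isSubgradientAt_const_mul hκ hv
    simpa only [EReal.coe_mul, mul_assoc] using this
  -- The fixed point of the iteration whose shadow is `p`.
  set zs : H := p + κ • (u + p - x) with hzs
  set w : ℕ → H := fun m =>
    prox (fun y => ((κ * γ : ℝ) : EReal) * f y) ((2 : ℝ) • zhalf m - z m) with hw
  have hstep : ∀ m, ‖z (m + 1) - zs‖ ^ 2 ≤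
      ‖z m - zs‖ ^ 2 - 2 * c * κ * ‖zhalf m - p‖ ^ 2 := by
    intro m
    have h1 : (1 + κ) * ‖zhalf m - p‖ ^ 2 ≤ ⟪zhalf m - p, z m - zs⟫ := by
      obtain ⟨hmem, hang⟩ := proj_mem_and_inner_le_zero hne hC hconv
        ((1 + κ)⁻¹ • (z m + κ • x))
      rw [← hz.half m] at hmem hang
      have hκ1 : 0 < 1 + κ := by linarith
      have ha := hang p hpC
      have hb := mul_nonpos_of_nonneg_of_nonpos hκ.le (hu _ hmem)
      have hcc := mul_nonpos_of_nonneg_of_nonpos hκ1.le ha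
      rw [← real_inner_smul_left] at hb hcc
      have e1 : (1 + κ) • ((1 + κ)⁻¹ • (z m + κ • x) - zhalf m)
          = (z m + κ • x) - (1 + κ) • zhalf m := by
        rw [smul_sub, smul_inv_smul₀ hκ1.ne']
      have e2 : (z m + κ • x) - (1 + κ) • zhalf m
          = (z m - zs) + κ • u - (1 + κ) • (zhalf m - p) := by
        rw [hzs]
        module
      rw [e1, e2, ← neg_sub (zhalf m) p, inner_neg_right, inner_sub_left, inner_add_left,
        real_inner_smul_left (zhalf m - p), real_inner_self_eq_norm_sq,
        real_inner_comm (zhalf m - p) (z m - zs)] at hcc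
      linarith
    have h2 : ⟪w m - p, z m - zs⟫ ≤ 2 * ⟪w m - p, zhalf m - p⟫ - ‖w m - p‖ ^ 2 := by
      have hwm := (hg.isProxPoint_iff.1
        (hg.isProxPoint_prox ((2 : ℝ) • zhalf m - z m))).inner_nonneg hv'
      change 0 ≤ ⟪(2 : ℝ) • zhalf m - z m - w m - κ • (x - p - u), w m - p⟫ at hwm
      have e : (2 : ℝ) • zhalf m - z m - w m - κ • (x - p - u)
          = (2 : ℝ) • (zhalf m - p) - (z m - zs) - (w m - p) := by
        rw [hzs]
        module
      rw [e, real_inner_comm, inner_sub_right, inner_sub_right, real_inner_smul_right,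
        real_inner_self_eq_norm_sq] at hwm
      linarith
    have h3 := sq_norm_add_smul_sub_le (hc.le.trans (hcτ m)) (hτ m) h1 h2
    have e : z (m + 1) - zs = z m - zs + τ m • (w m - p - (zhalf m - p)) := by
      rw [hz.next m, sub_sub_sub_cancel_right]
      abel
    rw [e]
    have h4 : c * (κ * ‖zhalf m - p‖ ^ 2) ≤ τ m * (κ * ‖zhalf m - p‖ ^ 2) :=
      mul_le_mul_of_nonneg_right (hcτ m) (by positivity)
    linarith
  have hlim := tendsto_zero_of_sq_norm_le (d := fun m => z m - zs) (α := fun m => zhalf m - p)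
    (show 0 < 2 * c * κ by positivity) hstep
  simpa using hlim.add_const p

/-- Started from `2q - x`, where `q ∈ C` is the proximal point of `γf` at `x`, the iteration with
`κ = 1` is stationary. -/
theorem IsDouglasRachford.zhalf_eq {C : Set H} {γ : ℝ} {x q : H} {τ : ℕ → ℝ} {z zhalf : ℕ → H}
    (hz : IsDouglasRachford C f γ 1 x τ z zhalf)
    (hq : prox (fun y => (γ : EReal) * f y) x = q) (hqC : q ∈ C) (hz0 : z 0 = (2 : ℝ) • q - x)
    (m : ℕ) : zhalf m = q := by
  have hhalf : ∀ m, z m = (2 : ℝ) • q - x → zhalf m = q := by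
    intro m hm
    have : (1 + 1 : ℝ)⁻¹ • (z m + (1 : ℝ) • x) = q := by
      rw [hm]
      module
    rw [hz.half m, this, proj_eq_self hqC]
  have hconst : ∀ m, z m = (2 : ℝ) • q - x := by
    intro m
    induction m with
    | zero => exact hz0
    | succ m ih =>
      rw [hz.next m, hhalf m ih, ih, one_mul, sub_sub_cancel, hq, sub_self, smul_zero, add_zero]
  exact hhalf m (hconst m)

end DouglasRachford

end ConvexProx

end

theorem proposition3p4 {H : Type*} [NormedAddCommGroup H] [InnerProductSpace ℝ H]
    [CompleteSpace H] [TopologicalSpace.SeparableSpace H]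
    (f : H → EReal) (hf : ConvexProx.Gamma0 f)
    (C : Set H) (hC_nonempty : C.Nonempty) (hC_closed : IsClosed C) (hC_convex : Convex ℝ C)
    (hqual : (C ∩ interior (ConvexProx.dom f)).Nonempty ∨
      (ConvexProx.dom f ∩ interior C).Nonempty ∨
      (FiniteDimensional ℝ H ∧
        (intrinsicInterior ℝ C ∩ intrinsicInterior ℝ (ConvexProx.dom f)).Nonempty))
    (γ : ℝ) (hγ : 0 < γ) (x : H)
    (τ : ℕ → ℝ) (hτ_inf : ∃ c : ℝ, 0 < c ∧ ∀ m, c ≤ τ m) (hτ_sup : ∀ m, τ m ≤ 2) :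
    -- the proximal point to be computed is well defined
    (∃! p : H, ConvexProx.IsProxPoint
      (fun y => ConvexProx.indicator C y + (γ : EReal) * f y) x p) ∧
    -- strong convergence, for every parameter and every starting point
    (∀ (κ : ℝ) (z zhalf : ℕ → H), 0 < κ →
      ConvexProx.IsDouglasRachford C f γ κ x τ z zhalf →
      Tendsto zhalf atTop
        (𝓝 (ConvexProx.prox (fun y => ConvexProx.indicator C y + (γ : EReal) * f y) x))) ∧
    -- immediate convergence for the special parameter and starting point
    (∀ z zhalf : ℕ → H, ConvexProx.IsDouglasRachford C f γ 1 x τ z zhalf →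
      z 0 = (2 : ℝ) • ConvexProx.prox (fun y => (γ : EReal) * f y) x - x →
      ConvexProx.prox (fun y => (γ : EReal) * f y) x ∈ C →
      ∀ m, zhalf m =
        ConvexProx.prox (fun y => ConvexProx.indicator C y + (γ : EReal) * f y) x) := by
  have hg : ConvexProx.Gamma0 fun y => (γ : EReal) * f y := hf.const_mul hγ
  have hq : ConvexProx.Qualified C fun y => (γ : EReal) * f y := by
    rwa [ConvexProx.Qualified, ConvexProx.dom_const_mul hf hγ]
  have hh : ConvexProx.Gamma0 fun y => ConvexProx.indicator C y + (γ : EReal) * f y :=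
    hg.indicator_add hC_closed hC_convex hq.inter_nonempty
  refine ⟨?_, ?_, ?_⟩
  · exact ⟨_, hh.isProxPoint_prox x, fun q hqx => (hh.prox_eq hqx).symm⟩
  · intro κ z zhalf hκ hz
    obtain ⟨c, hc, hcτ⟩ := hτ_inf
    obtain ⟨u, hpC, hu, hv⟩ := hg.exists_normal_add_subgradient hC_convex hq
      (hh.isProxPoint_iff.1 (hh.isProxPoint_prox x))
    exact hz.tendsto hf hC_nonempty hC_closed hC_convex hγ hκ hpC hu hv hc hcτ hτ_sup
  · intro z zhalf hz hz0 hmem m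
    rw [hz.zhalf_eq rfl hmem hz0 m]
    -- A minimizer over the whole space that lies in `C` also minimizes over `C`.
    refine (hh.prox_eq (hh.isProxPoint_iff_toReal.2 ?_)).symm
    obtain ⟨hfin, hmin⟩ := hg.isProxPoint_iff_toReal.1 (hg.isProxPoint_prox x)
    refine ⟨(ConvexProx.indicator_add_ne_top_iff hg).2 ⟨hmem, hfin⟩, fun y hy => ?_⟩
    obtain ⟨hyC, hy'⟩ := (ConvexProx.indicator_add_ne_top_iff hg).1 hy
    simpa only [ConvexProx.indicator_add_of_mem hmem, ConvexProx.indicator_add_of_mem hyC]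
      using hmin y hy'
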